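/- Let $p$ be an odd prime, $\mathbf{F}$ a field of characteristic $p$, and $L=\bigoplus_{i\ge 1}L_i$ an infinite-dimensional graded Lie algebra of maximal class over $\mathbf{F}$; that is, $L$ is a graded Lie algebra generated by $L_1$, with $\dim L_1=2$ and $\dim L_i\le 1$ for all $i\ge 2$. For $m\ge 2$ let $C_m=C_{L_1}(L_m)=\{u\in L_1 : [v,u]=0 \text{ for all } v\in L_m\}$ be the two-step centralizers of $L$. List the distinct subspaces occurring in the sequence $C_2,C_3,\dots$ in order of their first occurrence; thus the $i$-th two-step centralizer ($i\ge 1$) is the $i$-th distinct subspace to appear in this sequence. If $L$ has an $i$-th two-step centralizer $D$, then $D$ appears for the first time as $C_{L_1}(L_{2p^n})$ for some integer $n\ge i-1$; that is, $D=C_{2p^n}$ and $D\ne C_j$ for all $2\le j<2p^n$. -/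

import Mathlib

/-- `L = ⨁_{i ≥ 1} 𝒜 i` is an algebra of maximal class: a graded Lie algebra, graded over the
positive integers (the component of index `0` is zero), generated by `𝒜 1`, with
`dim (𝒜 1) = 2` and `dim (𝒜 i) ≤ 1` for `i ≥ 2`. -/
structure IsAlgebraOfMaximalClass (F : Type*) {L : Type*} [Field F] [LieRing L] [LieAlgebra F L]
    (𝒜 : ℕ → Submodule F L) : Prop where
  isInternal : DirectSum.IsInternal 𝒜
  component_zero : 𝒜 0 = ⊥
  lie_mem : ∀ i j : ℕ, ∀ u ∈ 𝒜 i, ∀ v ∈ 𝒜 j, ⁅u, v⁆ ∈ 𝒜 (i + j)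
  rank_one : Module.rank F (𝒜 1) = 2
  rank_le_one : ∀ i : ℕ, 2 ≤ i → Module.rank F (𝒜 i) ≤ 1
  generated : LieSubalgebra.lieSpan F L (𝒜 1 : Set L) = ⊤

/-- The two-step centralizer `C_{L_1}(L_i)`: the elements of `𝒜 1` that commute with all of
`𝒜 i`. -/
def twoStepCentralizer {F L : Type*} [Field F] [LieRing L] [LieAlgebra F L]
    (𝒜 : ℕ → Submodule F L) (i : ℕ) : Submodule F L where
  carrier := {u | u ∈ 𝒜 1 ∧ ∀ v ∈ 𝒜 i, ⁅v, u⁆ = 0}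
  zero_mem' := ⟨Submodule.zero_mem _, fun v _ => lie_zero v⟩
  add_mem' := fun ha hb =>
    ⟨Submodule.add_mem _ ha.1 hb.1, fun v hv => by rw [lie_add, ha.2 v hv, hb.2 v hv, add_zero]⟩
  smul_mem' := fun c _ ha =>
    ⟨Submodule.smul_mem _ c ha.1, fun v hv => by rw [lie_smul, ha.2 v hv, smul_zero]⟩

/-- `D` appears for the first time, in the sequence `C_{L_1}(L_2), C_{L_1}(L_3), …` of two-step
centralizers, as `C_{L_1}(L_m)`. -/
def FirstOccursAt {F L : Type*} [Field F] [LieRing L] [LieAlgebra F L]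
    (𝒜 : ℕ → Submodule F L) (D : Submodule F L) (m : ℕ) : Prop :=
  2 ≤ m ∧ twoStepCentralizer 𝒜 m = D ∧
    ∀ j : ℕ, 2 ≤ j → j < m → twoStepCentralizer 𝒜 j ≠ D

/-- `D` is the `i`-th two-step centralizer in order of occurrence (counting from `i = 1`): when
`D` first occurs, in weight `m` say, exactly `i` distinct subspaces (the last one being `D`)
have appeared among `C_{L_1}(L_2), …, C_{L_1}(L_m)`. -/
def IsNthTwoStepCentralizer {F L : Type*} [Field F] [LieRing L] [LieAlgebra F L]
    (𝒜 : ℕ → Submodule F L) (i : ℕ) (D : Submodule F L) : Prop :=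
  ∃ m : ℕ, FirstOccursAt 𝒜 D m ∧ (twoStepCentralizer 𝒜 '' Set.Icc 2 m).ncard = i

/-!
Extend the scalars to `K = F(t)`, let `x, y` span `L_1`, and put `z = x + t y`. The left-normed
brackets `v i = [y, z, …, z]` span the components over `K`, so `[v i, v j] = c i j • v (i + j)` for
a table `c` satisfying the Jacobi identity and, as `[·, z]` is a derivation, the Leibniz rule
`c i j = c (i + 1) j + c i (j + 1)`. The centralizer `C_i` is determined by `c i 1`, which is `0` or
`1 / (t - r)` with `r ∈ F`; these elements of `K` are affinely independent over `F`.

Replacing `y` by `y - c 2 1 • z`, we may assume that `c 2 1 = 0`. If a nonzero value first occurs in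
the first column at `m`, an `F`-linear map isolates it from the others, and the Leibniz rule in the
resulting `F`-valued table forces `2 * p ∣ m`. In characteristic `p` the derivation `[·, z]^p`
yields the same kind of structure on the entries `c (p * i) (p * j)`. Each entry of its first column
is the sum of a block of `p` consecutive entries `c l 1`, at most one of which is nonzero. Hence
passing to it divides the first occurrences of nonzero values by `p` and loses at most the value
`0`. By induction every first occurrence is at some `2 * p ^ n`, preceded by at most `n` other
values.
-/

open Finset
open scoped TensorProduct

/-! ### Preliminaries -/

theorem exists_linearMap_eq_one_of_affineIndependent {k V : Type*} [Field k] [AddCommGroup V]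
    [Module k V] {S : Set V} (hS : AffineIndependent k ((↑) : S → V)) (hzero : 0 ∈ S) {a : V}
    (ha : a ∈ S) (ha0 : a ≠ 0) : ∃ φ : V →ₗ[k] k, φ a = 1 ∧ ∀ b ∈ S, b ≠ a → φ b = 0 := by
  have himage : (· -ᵥ (0 : V)) '' (S \ {0}) = S \ {0} := by simp
  rw [affineIndependent_set_iff_linearIndependent_vsub k hzero, himage] at hS
  have hspan := linearIndepOn_iff_notMem_span.mp (show LinearIndepOn k id (S \ {0}) from hS) a
    ⟨ha, ha0⟩
  rw [Set.image_id] at hspan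
  obtain ⟨ψ, hψa, hψ⟩ := Submodule.exists_le_ker_of_notMem hspan
  refine ⟨(ψ a)⁻¹ • ψ, inv_mul_cancel₀ hψa, fun b hb hba => ?_⟩
  have hψb : ψ b = 0 := by
    rcases eq_or_ne b 0 with rfl | hb0
    · exact map_zero ψ
    · exact hψ (Submodule.subset_span ⟨⟨hb, hb0⟩, hba⟩)
  rw [LinearMap.smul_apply, hψb, smul_zero]

theorem neg_one_pow_mul_choose_prime_sub_one {R : Type*} [CommRing R] {p : ℕ} (hp : p.Prime)
    [CharP R p] : ∀ k < p, (-1 : R) ^ k * ((p - 1).choose k : R) = 1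
  | 0, _ => by simp
  | k + 1, hk => by
    have hprev := neg_one_pow_mul_choose_prime_sub_one (R := R) hp k (by omega)
    have hpascal : ((p - 1).choose k + (p - 1).choose (k + 1) : R) = 0 := by
      rw [← Nat.cast_add, ← Nat.choose_succ_succ', Nat.sub_add_cancel hp.one_le,
        CharP.cast_eq_zero_iff R p]
      exact hp.dvd_choose_self k.succ_ne_zero hk
    linear_combination hprev - (-1) ^ k * hpascal

theorem ncard_image_le_of_forall_eq {α β γ : Type*} {f : α → β} {g : α → γ} {S : Set α}
    (hS : S.Finite) (h : ∀ a ∈ S, ∀ b ∈ S, g a = g b → f a = f b) :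
    (f '' S).ncard ≤ (g '' S).ncard := by
  obtain rfl | ⟨a₀, -⟩ := S.eq_empty_or_nonempty
  · simp
  have : Nonempty α := ⟨a₀⟩
  refine Set.ncard_le_ncard_of_injOn (g ∘ Function.invFunOn f S) ?_ ?_ (hS.image g)
  · exact fun a ha => ⟨_, Function.invFunOn_mem ha, rfl⟩
  · intro a ha b hb hab
    rw [← Function.invFunOn_eq ha, ← Function.invFunOn_eq hb]
    exact h _ (Function.invFunOn_mem ha) _ (Function.invFunOn_mem hb) hab

theorem lieSpan_toSubmodule_le_of_lie_mem {R L : Type*} [CommRing R] [LieRing L] [LieAlgebra R L]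
    {S : Set L} {T : Submodule R L} (hST : S ⊆ T) (hT : ∀ u ∈ T, ∀ v ∈ S, ⁅u, v⁆ ∈ T) :
    (LieSubalgebra.lieSpan R L S).toSubmodule ≤ T := by
  have hstable : ∀ v ∈ LieSubalgebra.lieSpan R L S, ∀ u ∈ T, ⁅u, v⁆ ∈ T := by
    intro v hv
    induction hv using LieSubalgebra.lieSpan_induction with
    | mem v hv => exact fun u hu => hT u hu v hv
    | zero => simp
    | add v w _ _ hv hw => exact fun u hu => lie_add u v w ▸ T.add_mem (hv u hu) (hw u hu)
    | smul r v _ hv => exact fun u hu => lie_smul r u v ▸ T.smul_mem r (hv u hu)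
    | lie v w _ _ hv hw =>
      intro u hu
      rw [leibniz_lie, ← lie_skew v]
      exact T.add_mem (hw _ (hv u hu)) (T.neg_mem (hv _ (hw u hu)))
  intro u hu
  induction hu using LieSubalgebra.lieSpan_induction with
  | mem u hu => exact hST hu
  | zero => exact T.zero_mem
  | add u v _ _ hu hv => exact T.add_mem hu hv
  | smul r u _ hu => exact T.smul_mem r hu
  | lie u v _ hv hu _ => exact hstable v hv u hu

theorem algebraMap_add_algebraMap_mul_ne_zero {F K : Type*} [CommRing F]
    [CommRing K] [Algebra F K] {t : K} (ht : Transcendental F t) {a b : F} (hab : a ≠ 0 ∨ b ≠ 0) :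
    algebraMap F K a + algebraMap F K b * t ≠ 0 := by
  intro h
  have hpoly := transcendental_iff.mp ht (.C b * .X + .C a) (by simpa [add_comm] using h)
  have ha : a = 0 := by simpa using congrArg (Polynomial.coeff · 0) hpoly
  have hb : b = 0 := by simpa using congrArg (Polynomial.coeff · 1) hpoly
  exact hab.elim (· ha) (· hb)

theorem affineIndependent_insert_zero_range_sub_inv {F K : Type*} [Field F] [Field K]
    [Algebra F K] {t : K} (ht : Transcendental F t) :
    AffineIndependent F
      ((↑) : (insert 0 (Set.range fun a => (t - algebraMap F K a)⁻¹) : Set K) → K) := by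
  have hne : ∀ v ∈ Set.range fun a => (t - algebraMap F K a)⁻¹, v ≠ 0 := by
    rintro _ ⟨a, rfl⟩
    exact ht.linearIndependent_sub_inv.ne_zero a
  have := (linearIndependent_set_iff_affineIndependent_vadd_union_singleton F hne (0 : K)).mp
    ht.linearIndependent_sub_inv.linearIndepOn_id
  have himage : (· +ᵥ (0 : K)) '' (Set.range fun a => (t - algebraMap F K a)⁻¹) =
      Set.range fun a => (t - algebraMap F K a)⁻¹ := by simp
  rwa [himage, Set.singleton_union] at this

theorem eq_of_algebraMap_add_mul_eq_zero {F K : Type*} [CommRing F] [CommRing K] [IsDomain K]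
    [Algebra F K] {t : K} (ht : Transcendental F t) {r s : F} (hrs : r ≠ 0 ∨ s ≠ 0) {c c' : K}
    (hc : algebraMap F K r + (algebraMap F K s - algebraMap F K r * t) * c = 0)
    (hc' : algebraMap F K r + (algebraMap F K s - algebraMap F K r * t) * c' = 0) : c = c' := by
  have hne := algebraMap_add_algebraMap_mul_ne_zero ht (a := s) (b := -r) (by simpa using hrs.symm)
  rw [map_neg, neg_mul, ← sub_eq_add_neg] at hne
  exact mul_left_cancel₀ hne (by linear_combination hc - hc')

theorem mem_insert_zero_range_sub_inv_of_algebraMap_add_mul_eq_zero {F K : Type*} [Field F]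
    [Field K] [Algebra F K] {t : K} (ht : Transcendental F t) {r s : F} (hrs : r ≠ 0 ∨ s ≠ 0)
    {c : K} (hc : algebraMap F K r + (algebraMap F K s - algebraMap F K r * t) * c = 0) :
    c ∈ insert 0 (Set.range fun a => (t - algebraMap F K a)⁻¹) := by
  rcases eq_or_ne r 0 with rfl | hr
  · exact Or.inl (eq_of_algebraMap_add_mul_eq_zero ht hrs hc (by simp))
  · refine Or.inr ⟨s / r, eq_of_algebraMap_add_mul_eq_zero ht hrs ?_ hc⟩
    have hne : t - algebraMap F K (s / r) ≠ 0 :=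
      inv_eq_zero.not.mp (ht.linearIndependent_sub_inv.ne_zero _)
    have hs : algebraMap F K s = algebraMap F K r * algebraMap F K (s / r) := by
      rw [← map_mul, mul_div_cancel₀ _ hr]
    rw [hs]
    linear_combination -algebraMap F K r * mul_inv_cancel₀ hne

theorem tmul_ne_zero {F K V : Type*} [Field F] [Field K] [Algebra F K] [AddCommGroup V]
    [Module F V] {s : K} {v : V} (hs : s ≠ 0) (hv : v ≠ 0) : s ⊗ₜ[F] v ≠ 0 := by
  rw [← mul_one s, ← smul_eq_mul, ← TensorProduct.smul_tmul']
  exact smul_ne_zero hs fun h => hv ((Module.FaithfullyFlat.one_tmul_eq_zero_iff F V v).mp h)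

theorem tmul_smul_eq_mul_algebraMap_tmul {F K V : Type*} [CommSemiring F] [CommSemiring K]
    [Algebra F K] [AddCommMonoid V] [Module F V] (s : K) (a : F) (v : V) :
    s ⊗ₜ[F] (a • v) = (s * algebraMap F K a) ⊗ₜ[F] v := by
  rw [TensorProduct.tmul_smul, TensorProduct.smul_tmul', Algebra.smul_def, mul_comm]

/-! ### Tables of structure constants -/

/-- An alternating table of structure constants, indexed by the positive integers, on which the
shift of the index acts as a derivation. Entries with an index `0` are junk. -/
structure IsLeibnizTable {A : Type*} [AddCommGroup A] (g : ℕ → ℕ → A) : Prop where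
  self : ∀ i, 1 ≤ i → g i i = 0
  skew : ∀ i j, 1 ≤ i → 1 ≤ j → g i j = -g j i
  leibniz : ∀ i j, 1 ≤ i → 1 ≤ j → g i j = g (i + 1) j + g i (j + 1)

namespace IsLeibnizTable

theorem map {A B : Type*} [AddCommGroup A] [AddCommGroup B] {g : ℕ → ℕ → A}
    (hg : IsLeibnizTable g) (φ : A →+ B) : IsLeibnizTable fun i j => φ (g i j) where
  self i hi := by rw [hg.self i hi, map_zero]
  skew i j hi hj := by rw [hg.skew i j hi hj, map_neg]
  leibniz i j hi hj := by rw [hg.leibniz i j hi hj, map_add]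

section Ring

variable {R : Type*} [CommRing R] {g : ℕ → ℕ → R}

theorem apply_add_eq_sum (hg : IsLeibnizTable g) {i j : ℕ} (hi : 1 ≤ i) (hj : 1 ≤ j) (n : ℕ) :
    g i (j + n) = ∑ k ∈ range (n + 1), n.choose k * ((-1) ^ k * g (i + k) j) := by
  rw [← Nat.sum_antidiagonal_eq_sum_range_succ fun k _ => n.choose k * ((-1) ^ k * g (i + k) j)]
  induction n generalizing i with
  | zero => simp
  | succ n ih =>
    have hleibniz : g i (j + (n + 1)) = g i (j + n) - g (i + 1) (j + n) := by
      rw [hg.leibniz i (j + n) hi (by omega), add_sub_cancel_left, add_assoc]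
    rw [Finset.sum_antidiagonal_choose_succ_mul fun k _ => (-1) ^ k * g (i + k) j, hleibniz, ih hi,
      ih (by omega), sub_eq_add_neg, ← sum_neg_distrib]
    congr 1
    refine sum_congr rfl fun kl hkl => ?_
    rw [Nat.choose_symm_of_eq_add (mem_antidiagonal.mp hkl).symm, add_right_comm, add_assoc]
    ring

theorem apply_add_eq_of_eq_zero (hg : IsLeibnizTable g) {i n : ℕ} (hi : 1 ≤ i)
    (hzero : ∀ k < n, g (i + k) 1 = 0) : g i (1 + n) = (-1) ^ n * g (i + n) 1 := by
  rw [hg.apply_add_eq_sum hi le_rfl, sum_range_succ, sum_eq_zero fun k hk => ?_]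
  · simp
  · rw [hzero k (mem_range.mp hk), mul_zero, mul_zero]

theorem apply_add_succ_eq_of_eq_zero (hg : IsLeibnizTable g) {i n : ℕ} (hi : 1 ≤ i)
    (hzero : ∀ k < n, g (i + k) 1 = 0) (hsucc : g (i + (n + 1)) 1 = 0) :
    g i (1 + (n + 1)) = (-1) ^ n * (n + 1) * g (i + n) 1 := by
  rw [hg.apply_add_eq_sum hi le_rfl, sum_range_succ, sum_range_succ, sum_eq_zero fun k hk => ?_,
    hsucc]
  · push_cast [Nat.choose_succ_self_right]
    ring
  · rw [hzero k (mem_range.mp hk), mul_zero, mul_zero]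

variable {p : ℕ} [CharP R p]

theorem apply_eq_add_prime (hp : p.Prime) (hg : IsLeibnizTable g) {i j : ℕ} (hi : 1 ≤ i)
    (hj : 1 ≤ j) : g i j = g (i + p) j + g i (j + p) := by
  have := Fact.mk hp
  rw [hg.apply_add_eq_sum hi hj, sum_range_succ, sum_eq_single_of_mem 0 (by simp [hp.pos])]
  · simp [neg_one_pow_char]
  · intro k hk hk0
    rw [(CharP.cast_eq_zero_iff R p _).mpr (hp.dvd_choose_self hk0 (mem_range.mp hk)), zero_mul]

theorem apply_prime_eq_sum (hp : p.Prime) (hg : IsLeibnizTable g) {i : ℕ} (hi : 1 ≤ i) :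
    g i p = ∑ k ∈ range p, g (i + k) 1 := by
  have hsum := hg.apply_add_eq_sum hi le_rfl (p - 1)
  rw [Nat.add_sub_cancel' hp.one_le, Nat.sub_add_cancel hp.one_le] at hsum
  rw [hsum]
  refine sum_congr rfl fun k hk => ?_
  rw [← mul_assoc, mul_comm (Nat.cast _),
    neg_one_pow_mul_choose_prime_sub_one hp k (mem_range.mp hk), one_mul]

theorem even_of_first_ne_zero [IsDomain R] (htwo : (2 : R) ≠ 0) (hg : IsLeibnizTable g) {m : ℕ}
    (hm : 1 ≤ m) (hzero : ∀ i, 1 ≤ i → i < m → g i 1 = 0) (hne : g m 1 ≠ 0) : Even m := by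
  by_contra hodd
  obtain ⟨k, rfl⟩ := Nat.not_even_iff_odd.mp hodd
  have hrow := hg.apply_add_eq_of_eq_zero (i := 1) (n := 2 * k) le_rfl
    fun l hl => hzero (1 + l) (by omega) (by omega)
  rw [add_comm 1, hg.skew _ _ le_rfl hm, pow_mul, neg_one_sq, one_pow, one_mul] at hrow
  exact mul_ne_zero htwo hne (by linear_combination -hrow)

theorem two_mul_char_dvd_of_isolated [IsDomain R] (htwo : (2 : R) ≠ 0)
    (hg : IsLeibnizTable g) {m : ℕ} (hm : 1 ≤ m) (hzero : ∀ i, 1 ≤ i → i < m → g i 1 = 0)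
    (hne : g m 1 ≠ 0) (hsucc : g (m + 1) 1 = 0) : 2 * p ∣ m := by
  obtain ⟨k, rfl⟩ := (hg.even_of_first_ne_zero htwo hm hzero hne).two_dvd
  obtain ⟨n, rfl⟩ : ∃ n, k = n + 1 := ⟨k - 1, by omega⟩
  -- Expanding the diagonal entry at `m / 2` along the first column leaves `± (m / 2) * g m 1`.
  have hdiag := hg.apply_add_succ_eq_of_eq_zero (i := n + 2) (n := n) (by omega)
    (fun l hl => hzero _ (by omega) (by omega))
    (by rwa [show n + 2 + (n + 1) = 2 * (n + 1) + 1 by ring])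
  rw [show 1 + (n + 1) = n + 2 by ring, hg.self _ (by omega), show n + 2 + n = 2 * (n + 1) by ring]
    at hdiag
  have hcast : ((n + 1 : ℕ) : R) = 0 := by simpa [hne] using hdiag.symm
  exact mul_dvd_mul_left 2 ((CharP.cast_eq_zero_iff R p _).mp hcast)

end Ring

end IsLeibnizTable

/-- Structure constants of a Lie algebra with homogeneous basis `z, v 1, v 2, …`, where
`[v i, z] = v (i + 1)` and `[v i, v j] = c i j • v (i + j)`. The Leibniz rule is the Jacobi identity
for triples involving `z`. -/
structure IsBracketTable {K : Type*} [CommRing K] (c : ℕ → ℕ → K) : Prop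
    extends IsLeibnizTable c where
  jacobi : ∀ i j l, 1 ≤ i → 1 ≤ j → 1 ≤ l →
    c i j * c (i + j) l + c j l * c (j + l) i + c l i * c (l + i) j = 0

/-- A bracket table whose distinct values `c i 1`, `2 ≤ i`, are affinely independent over `k`, so
that a single value can be isolated by a `k`-linear map. After extension of scalars, the value
`c i 1` determines the two-step centralizer in degree `i`, the kernel of the bracket of `v i` with
the span of `z` and `v 1`. -/
structure IsSeparatedTable (k : Type*) {K : Type*} [Field k] [CommRing K] [Algebra k K]
    (c : ℕ → ℕ → K) : Prop extends IsBracketTable c where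
  affineIndependent : AffineIndependent k ((↑) : (c · 1) '' Set.Ici 2 → K)

/-- The table obtained by replacing the basis element `v 1` by `v 1 - s • z`, where `z` is the
element inducing the shift `[v i, z] = v (i + 1)`: it subtracts `s` from the values `c i 1`,
`2 ≤ i`. -/
def shear {K : Type*} [CommRing K] (s : K) (c : ℕ → ℕ → K) (i j : ℕ) : K :=
  c i j - s * ((if j = 1 then 1 else 0) - (if i = 1 then 1 else 0))

/-- The table of the subalgebra with basis `v p, v (2 * p), …` and with the `p`-th power of the
shift in place of the shift. -/
def deflation {K : Type*} (p : ℕ) (c : ℕ → ℕ → K) (i j : ℕ) : K :=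
  c (p * i) (p * j)

/-- The value `f m` does not occur earlier in the sequence `f 2, f 3, …`, which starts at index `2`
as the sequence of two-step centralizers does. -/
def IsFirstOccurrence {α : Type*} (f : ℕ → α) (m : ℕ) : Prop :=
  2 ≤ m ∧ ∀ j, 2 ≤ j → j < m → f j ≠ f m

section Shear

variable {K : Type*} [CommRing K] {c : ℕ → ℕ → K}

theorem shear_apply_one (s : K) {j : ℕ} (hj : 2 ≤ j) : shear s c j 1 = c j 1 - s := by
  simp [shear, show j ≠ 1 by omega]

theorem image_shear_apply_one (s : K) {S : Set ℕ} (hS : ∀ j ∈ S, 2 ≤ j) :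
    (shear s c · 1) '' S = (· - s) '' ((c · 1) '' S) := by
  rw [Set.image_image, Set.image_congr fun j hj => shear_apply_one s (hS j hj)]

theorem IsBracketTable.shear (hc : IsBracketTable c) (s : K) :
    IsBracketTable (shear s c) where
  self i hi := by simp [_root_.shear, hc.self i hi]
  skew i j hi hj := by simp only [_root_.shear, hc.skew i j hi hj]; ring
  leibniz i j hi hj := by
    simp only [_root_.shear, hc.leibniz i j hi hj, show i + 1 ≠ 1 by omega,
      show j + 1 ≠ 1 by omega, if_false]
    ring
  jacobi i j l hi hj hl := by
    -- The part of the Jacobi identity linear in `s` is the Leibniz rule.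
    have hlinear : ∀ i j l, 1 ≤ j → 1 ≤ l →
        (if i = 1 then (1 : K) else 0) * (c j l - c (i + j) l + c (l + i) j) = 0 := by
      intro i j l hj hl
      split_ifs with h
      · rw [h, add_comm 1 j, hc.leibniz j l hj hl, hc.skew (l + 1) j (by omega) hj]; ring
      · ring
    simp only [_root_.shear, show i + j ≠ 1 by omega, show j + l ≠ 1 by omega,
      show l + i ≠ 1 by omega, if_false]
    linear_combination hc.jacobi i j l hi hj hl - s * hlinear i j l hj hl -
      s * hlinear j l i hl hi - s * hlinear l i j hi hj

theorem IsSeparatedTable.shear {k : Type*} [Field k] [Algebra k K]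
    (hc : IsSeparatedTable k c) (s : K) : IsSeparatedTable k (shear s c) where
  toIsBracketTable := hc.toIsBracketTable.shear s
  affineIndependent := by
    have hshift : ⇑(AffineEquiv.constVAdd k K (-s)) = (· - s) := by
      ext a; simp [neg_add_eq_sub]
    rw [image_shear_apply_one s fun _ => Set.mem_Ici.mp, ← hshift]
    exact (AffineEquiv.affineIndependent_set_of_eq_iff _).mpr hc.affineIndependent

theorem IsFirstOccurrence.shear {m : ℕ} (hm : IsFirstOccurrence (c · 1) m) (s : K) :
    IsFirstOccurrence (shear s c · 1) m :=
  ⟨hm.1, fun j hj hjm h => hm.2 j hj hjm <| by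
    simpa [shear_apply_one s hj, shear_apply_one s hm.1] using h⟩

end Shear

theorem IsBracketTable.deflation {K : Type*} [CommRing K] {c : ℕ → ℕ → K} {p : ℕ} [CharP K p]
    (hp : p.Prime) (hc : IsBracketTable c) : IsBracketTable (deflation p c) where
  self i hi := hc.self _ (Nat.mul_pos hp.pos hi)
  skew i j hi hj := hc.skew _ _ (Nat.mul_pos hp.pos hi) (Nat.mul_pos hp.pos hj)
  leibniz i j hi hj := hc.apply_eq_add_prime hp (Nat.mul_pos hp.pos hi) (Nat.mul_pos hp.pos hj)
  jacobi i j l hi hj hl := by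
    simpa only [_root_.deflation, mul_add] using
      hc.jacobi _ _ _ (Nat.mul_pos hp.pos hi) (Nat.mul_pos hp.pos hj) (Nat.mul_pos hp.pos hl)

theorem IsBracketTable.apply_one_mul_apply_succ_one {K : Type*} [CommRing K] [IsDomain K]
    {c : ℕ → ℕ → K} (hc : IsBracketTable c) (hnorm : c 2 1 = 0) :
    ∀ i, 1 ≤ i → c i 1 * c (i + 1) 1 = 0 := by
  intro i hi
  induction i, hi using Nat.le_induction with
  | base => rw [hnorm, mul_zero]
  | succ i hi ih =>
    have hjac := hc.jacobi i 2 1 hi (by omega) le_rfl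
    rw [add_comm 1 i] at hjac
    have hjacobi : (c i 1 - c (i + 1) 1) * c (i + 2) 1 = c i 1 * (c (i + 1) 1 - c (i + 2) 1) := by
      linear_combination hjac - c 3 i * hnorm
        - c (i + 1) 2 * hc.skew 1 i le_rfl hi + c (i + 2) 1 * hc.leibniz i 1 hi le_rfl
        - c i 1 * hc.leibniz (i + 1) 1 (by omega) le_rfl
    rcases mul_eq_zero.mp ih with h | h
    · rw [h] at hjacobi
      linear_combination -hjacobi
    · rw [h, zero_mul]

namespace IsSeparatedTable

variable {k K : Type*} [Field k] [CommRing K] [IsDomain K] [Algebra k K] {c : ℕ → ℕ → K} {p : ℕ}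
  [CharP K p]

theorem two_mul_char_dvd_of_isFirstOccurrence (htwo : (2 : K) ≠ 0) (hc : IsSeparatedTable k c)
    (hnorm : c 2 1 = 0) {m : ℕ} (hm : IsFirstOccurrence (c · 1) m) (hne : c m 1 ≠ 0) :
    2 * p ∣ m := by
  obtain ⟨φ, hφm, hφ⟩ := exists_linearMap_eq_one_of_affineIndependent hc.affineIndependent
    ⟨2, Set.self_mem_Ici, hnorm⟩ ⟨m, hm.1, rfl⟩ hne
  have : CharP k p := (algebraMap k K).charP (algebraMap k K).injective p
  have htwo' : (2 : k) ≠ 0 := fun h =>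
    htwo (by rw [← map_ofNat (algebraMap k K) 2, h, map_zero])
  have hm1 : 1 ≤ m := by have := hm.1; omega
  refine (hc.toIsLeibnizTable.map φ.toAddMonoidHom).two_mul_char_dvd_of_isolated htwo' hm1
    (fun i hi him => ?_) (hφm.trans_ne one_ne_zero) ?_
  · rcases hi.eq_or_lt with rfl | hi
    · exact (congrArg φ (hc.self 1 le_rfl)).trans (map_zero φ)
    · exact hφ _ ⟨i, hi, rfl⟩ (hm.2 i hi him)
  · have hsucc : c (m + 1) 1 = 0 :=
      (mul_eq_zero.mp (hc.apply_one_mul_apply_succ_one hnorm m hm1)).resolve_left hne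
    exact (congrArg φ hsucc).trans (map_zero φ)

theorem apply_one_eq_zero_of_lt (htwo : (2 : K) ≠ 0) (hc : IsSeparatedTable k c)
    (hnorm : c 2 1 = 0) {j : ℕ} (hj : 1 ≤ j) (hjp : j < 2 * p) : c j 1 = 0 := by
  induction j using Nat.strong_induction_on with
  | _ j ih =>
    by_contra hne
    have hj2 : 2 ≤ j := by
      by_contra h
      exact hne (by rw [show j = 1 by omega, hc.self 1 le_rfl])
    have hfirst : IsFirstOccurrence (c · 1) j :=
      ⟨hj2, fun i hi hij => by simpa [ih i hij (by omega) (by omega)] using Ne.symm hne⟩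
    have hdvd : 2 * p ∣ j := hc.two_mul_char_dvd_of_isFirstOccurrence htwo hnorm hfirst hne
    exact absurd (Nat.le_of_dvd hj hdvd) (by omega)

theorem apply_add_one_eq_zero_of_ne_zero (htwo : (2 : K) ≠ 0) (hc : IsSeparatedTable k c)
    (hnorm : c 2 1 = 0) {i d : ℕ} (hi : 1 ≤ i) (hne : c i 1 ≠ 0) (hd : 0 < d) (hdp : d < p) :
    c (i + d) 1 = 0 := by
  induction d using Nat.strong_induction_on with
  | _ d ih =>
    obtain ⟨n, rfl⟩ : ∃ n, d = n + 1 := ⟨d - 1, by omega⟩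
    by_contra hne'
    have hsucc : c (i + (n + 1) + 1) 1 = 0 :=
      (mul_eq_zero.mp (hc.apply_one_mul_apply_succ_one hnorm _ (by omega))).resolve_left hne'
    have hcol : c (n + 2) 1 = 0 := hc.apply_one_eq_zero_of_lt htwo hnorm (by omega) (by omega)
    have hrow : c (i + 1) (n + 2) = (-1) ^ n * (n + 1) * c (i + (n + 1)) 1 := by
      have := hc.apply_add_succ_eq_of_eq_zero (i := i + 1) (n := n) (by omega)
        (fun l hl => by
          rw [add_assoc, add_comm 1 l]; exact ih (l + 1) (by omega) (by omega) (by omega))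
        (by rwa [show i + 1 + (n + 1) = i + (n + 1) + 1 by ring])
      rwa [show 1 + (n + 1) = n + 2 by ring, show i + 1 + n = i + (n + 1) by ring] at this
    have hjacobi := hc.jacobi i (n + 2) 1 hi (by omega) le_rfl
    rw [← add_assoc i, show i + n + 2 = i + (n + 1) + 1 by ring, hsucc, hcol, add_comm 1 i, hrow,
      hc.skew 1 i le_rfl hi] at hjacobi
    -- What remains is `(n + 1) * c i 1 * c (i + (n + 1)) 1 = 0`, up to sign.
    have hcast : ((n + 1 : ℕ) : K) = 0 := by simpa [hne, hne'] using hjacobi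
    exact absurd (Nat.le_of_dvd hd ((CharP.cast_eq_zero_iff K p _).mp hcast)) (by omega)

theorem deflation_div_apply_one (hp : p.Prime) (htwo : (2 : K) ≠ 0) (hc : IsSeparatedTable k c)
    (hnorm : c 2 1 = 0) {l : ℕ} (hl : 1 ≤ l / p) (hne : c l 1 ≠ 0) :
    deflation p c (l / p) 1 = c l 1 := by
  have hpos : 1 ≤ p * (l / p) := Nat.mul_pos hp.pos hl
  have hdiv := Nat.div_add_mod l p
  have hmod := Nat.mod_lt l hp.pos
  rw [deflation, mul_one, hc.apply_prime_eq_sum hp hpos,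
    sum_eq_single_of_mem (l % p) (mem_range.mpr hmod), hdiv]
  intro r hr hrl
  have hrp := mem_range.mp hr
  by_contra hne'
  rcases hrl.lt_or_gt with hlt | hgt
  · apply hne
    rw [← hc.apply_add_one_eq_zero_of_ne_zero htwo hnorm (by omega) hne' (d := l % p - r) (by omega)
      (by omega)]
    congr 1; omega
  · apply hne'
    rw [← hc.apply_add_one_eq_zero_of_ne_zero htwo hnorm (by omega) hne (d := r - l % p) (by omega)
      (by omega)]
    congr 1; omega

theorem deflation_apply_one_eq_zero_or (hp : p.Prime) (htwo : (2 : K) ≠ 0)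
    (hc : IsSeparatedTable k c) (hnorm : c 2 1 = 0) {j : ℕ} (hj : 1 ≤ j) :
    deflation p c j 1 = 0 ∨ ∃ l, l / p = j ∧ deflation p c j 1 = c l 1 := by
  by_cases hblock : ∃ r < p, c (p * j + r) 1 ≠ 0
  · obtain ⟨r, hr, hne⟩ := hblock
    have hdiv : (p * j + r) / p = j := by
      rw [Nat.mul_add_div hp.pos, Nat.div_eq_of_lt hr, add_zero]
    refine Or.inr ⟨p * j + r, hdiv, ?_⟩
    simpa only [hdiv] using hc.deflation_div_apply_one hp htwo hnorm (by rwa [hdiv]) hne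
  · push Not at hblock
    left
    rw [deflation, mul_one, hc.apply_prime_eq_sum hp (Nat.mul_pos hp.pos hj)]
    exact sum_eq_zero fun r hr => hblock r (mem_range.mp hr)

protected theorem deflation (hp : p.Prime) (htwo : (2 : K) ≠ 0) (hc : IsSeparatedTable k c)
    (hnorm : c 2 1 = 0) : IsSeparatedTable k (deflation p c) where
  toIsBracketTable := hc.toIsBracketTable.deflation hp
  affineIndependent := by
    refine hc.affineIndependent.mono ?_
    rintro _ ⟨j, hj, rfl⟩
    rw [Set.mem_Ici] at hj
    rcases hc.deflation_apply_one_eq_zero_or hp htwo hnorm (j := j) (by omega) with h | ⟨l, hl, h⟩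
    · exact ⟨2, Set.self_mem_Ici, hnorm.trans h.symm⟩
    · exact ⟨l, (hl ▸ hj).trans (Nat.div_le_self l p), h.symm⟩

theorem isFirstOccurrence_deflation (hp : p.Prime) (htwo : (2 : K) ≠ 0)
    (hc : IsSeparatedTable k c) (hnorm : c 2 1 = 0) {m : ℕ} (hm : 2 ≤ m)
    (hfirst : IsFirstOccurrence (c · 1) (p * m)) (hne : c (p * m) 1 ≠ 0) :
    IsFirstOccurrence (deflation p c · 1) m := by
  have hdiv : p * m / p = m := Nat.mul_div_cancel_left m hp.pos
  have hvalue : deflation p c m 1 = c (p * m) 1 := by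
    simpa only [hdiv] using hc.deflation_div_apply_one hp htwo hnorm (by omega) hne
  refine ⟨hm, fun j hj hjm => ?_⟩
  beta_reduce
  rw [hvalue]
  rcases hc.deflation_apply_one_eq_zero_or hp htwo hnorm (j := j) (by omega) with h | ⟨l, rfl, h⟩
  · rw [h]; exact hne.symm
  · rw [h]
    refine hfirst.2 l (hj.trans (Nat.div_le_self l p)) ?_
    rw [mul_comm]
    exact (Nat.div_lt_iff_lt_mul hp.pos).mp hjm

theorem image_Icc_subset_insert_deflation (hp : p.Prime) (htwo : (2 : K) ≠ 0)
    (hc : IsSeparatedTable k c) (hnorm : c 2 1 = 0) (m : ℕ) :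
    (c · 1) '' Set.Icc 2 (p * m) ⊆ insert 0 ((deflation p c · 1) '' Set.Icc 2 m) := by
  rintro _ ⟨l, ⟨hl2, hlm⟩, rfl⟩
  by_cases hl : c l 1 = 0
  · exact Or.inl hl
  have hpl : 2 * p ≤ l := by
    by_contra hlt
    exact hl (hc.apply_one_eq_zero_of_lt htwo hnorm (by omega) (by omega))
  have hdiv : 2 ≤ l / p := (Nat.le_div_iff_mul_le hp.pos).mpr hpl
  exact Or.inr ⟨l / p, ⟨hdiv, Nat.div_le_of_le_mul hlm⟩,
    hc.deflation_div_apply_one hp htwo hnorm (by omega) hl⟩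

theorem exists_eq_two_mul_prime_pow (hp : p.Prime) (htwo : (2 : K) ≠ 0)
    (hc : IsSeparatedTable k c) {m : ℕ} (hm : IsFirstOccurrence (c · 1) m) :
    ∃ n, m = 2 * p ^ n ∧ ((c · 1) '' Set.Icc 2 m).ncard ≤ n + 1 := by
  induction m using Nat.strong_induction_on generalizing c with
  | _ m ih =>
    wlog hnorm : c 2 1 = 0 generalizing c
    · obtain ⟨n, hn, hcard⟩ := this (hc.shear (c 2 1)) (hm.shear (c 2 1))
        (by rw [shear_apply_one _ le_rfl, sub_self])
      rw [image_shear_apply_one _ fun j hj => hj.1,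
        Set.ncard_image_of_injective _ (sub_left_injective (b := c 2 1))] at hcard
      exact ⟨n, hn, hcard⟩
    rcases hm.1.eq_or_lt with rfl | hlt
    · exact ⟨0, by simp, by simp⟩
    have hne : c m 1 ≠ 0 := fun h => hm.2 2 le_rfl hlt (hnorm.trans h.symm)
    obtain ⟨r, rfl⟩ : ∃ r, m = p * (2 * r) :=
      (hc.two_mul_char_dvd_of_isFirstOccurrence htwo hnorm hm hne).imp fun r hr => by rw [hr]; ring
    have hr : 1 ≤ r := Nat.pos_of_ne_zero fun h => by simp [h] at hlt
    obtain ⟨n, hn, hcard⟩ := ih (2 * r) (by nlinarith [hp.two_le]) (hc.deflation hp htwo hnorm)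
      (hc.isFirstOccurrence_deflation hp htwo hnorm (by omega) hm hne)
    refine ⟨n + 1, by rw [hn]; ring, ?_⟩
    calc ((c · 1) '' Set.Icc 2 (p * (2 * r))).ncard
        ≤ (insert 0 ((deflation p c · 1) '' Set.Icc 2 (2 * r))).ncard :=
          Set.ncard_le_ncard (hc.image_Icc_subset_insert_deflation hp htwo hnorm _)
            (((Set.finite_Icc 2 _).image _).insert 0)
      _ ≤ n + 1 + 1 := (Set.ncard_insert_le _ _).trans (by omega)

end IsSeparatedTable

theorem isBracketTable_of_lie_eq_smul {K M : Type*} [CommRing K] [IsDomain K] [LieRing M]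
    [LieAlgebra K M] [Module.IsTorsionFree K M] {v : ℕ → M} {z : M} {c : ℕ → ℕ → K}
    (hne : ∀ i, 2 ≤ i → v i ≠ 0) (hz : ∀ i, 1 ≤ i → ⁅v i, z⁆ = v (i + 1))
    (hc : ∀ i j, 1 ≤ i → 1 ≤ j → ⁅v i, v j⁆ = c i j • v (i + j)) : IsBracketTable c where
  self i hi := by
    refine (smul_eq_zero.mp ?_).resolve_right (hne (i + i) (by omega))
    rw [← hc i i hi hi, lie_self]
  skew i j hi hj := by
    refine smul_left_injective K (hne (i + j) (by omega)) ?_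
    simp only [neg_smul]
    rw [← hc i j hi hj, add_comm i j, ← hc j i hj hi, lie_skew]
  leibniz i j hi hj := by
    refine smul_left_injective K (hne (i + j + 1) (by omega)) ?_
    calc c i j • v (i + j + 1) = ⁅⁅v i, v j⁆, z⁆ := by
          rw [hc i j hi hj, smul_lie, hz _ (by omega)]
      _ = ⁅⁅v i, z⁆, v j⁆ + ⁅v i, ⁅v j, z⁆⁆ := by
          rw [lie_lie, sub_eq_neg_add, lie_skew]
      _ = (c (i + 1) j + c i (j + 1)) • v (i + j + 1) := by
          rw [hz i hi, hz j hj, hc _ _ (by omega) hj, hc _ _ hi (by omega), add_smul,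
            add_right_comm, add_assoc]
  jacobi i j l hi hj hl := by
    have htriple : ∀ i j l, 1 ≤ i → 1 ≤ j → 1 ≤ l →
        ⁅⁅v i, v j⁆, v l⁆ = (c i j * c (i + j) l) • v (i + j + l) := fun i j l hi hj hl => by
      rw [hc i j hi hj, smul_lie, hc _ _ (by omega) hl, smul_smul]
    refine (smul_eq_zero.mp ?_).resolve_right (hne (i + j + l) (by omega))
    rw [add_smul, add_smul, ← htriple i j l hi hj hl, show i + j + l = j + l + i by ring,
      ← htriple j l i hj hl hi, show j + l + i = l + i + j by ring, ← htriple l i j hl hi hj,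
      ← lie_skew ⁅v i, v j⁆, ← lie_skew ⁅v j, v l⁆, ← lie_skew ⁅v l, v i⁆, ← neg_add, ← neg_add,
      lie_jacobi, neg_zero]

/-! ### Algebras of maximal class -/

theorem mem_twoStepCentralizer_iff {F L : Type*} [Field F] [LieRing L] [LieAlgebra F L]
    {𝒜 : ℕ → Submodule F L} {i : ℕ} {w u : L} (hw : 𝒜 i = Submodule.span F {w}) :
    u ∈ twoStepCentralizer 𝒜 i ↔ u ∈ 𝒜 1 ∧ ⁅w, u⁆ = 0 := by
  refine and_congr_right fun _ => ⟨fun h => h w ?_, fun h v hv => ?_⟩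
  · exact hw ▸ Submodule.mem_span_singleton_self w
  · obtain ⟨a, rfl⟩ := Submodule.mem_span_singleton.mp (hw ▸ hv)
    rw [smul_lie, h, smul_zero]

namespace IsAlgebraOfMaximalClass

section Components

variable {F L : Type*} [Field F] [LieRing L] [LieAlgebra F L] {𝒜 : ℕ → Submodule F L}

theorem finiteDimensional_component (hL : IsAlgebraOfMaximalClass F 𝒜) (i : ℕ) :
    FiniteDimensional F (𝒜 i) := by
  rcases lt_trichotomy i 1 with hi | rfl | hi
  · obtain rfl : i = 0 := by omega
    rw [hL.component_zero]
    infer_instance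
  · exact Module.finite_of_rank_eq_nat hL.rank_one
  · exact Module.rank_lt_aleph0_iff.mp ((hL.rank_le_one i hi).trans_lt Cardinal.one_lt_aleph0)

theorem exists_component_one_eq_span_pair (hL : IsAlgebraOfMaximalClass F 𝒜) :
    ∃ x y : L, 𝒜 1 = Submodule.span F {x, y} := by
  have := hL.finiteDimensional_component 1
  let b := Module.finBasisOfFinrankEq F (𝒜 1) (Module.finrank_eq_of_rank_eq hL.rank_one)
  refine ⟨b 0, b 1, ?_⟩
  have hspan := congrArg (Submodule.map (𝒜 1).subtype) b.span_eq
  rw [Submodule.map_top, Submodule.range_subtype, Submodule.map_span, ← Set.range_comp] at hspan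
  refine hspan.symm.trans (congrArg _ ?_)
  ext; simp [Fin.exists_fin_two, eq_comm]

theorem component_eq_span_singleton (hL : IsAlgebraOfMaximalClass F 𝒜) {i : ℕ} (hi : 2 ≤ i)
    {w : L} (hw : w ∈ 𝒜 i) (hw0 : w ≠ 0) : 𝒜 i = Submodule.span F {w} := by
  obtain ⟨v, -, hv⟩ := (rank_submodule_le_one_iff _).mp (hL.rank_le_one i hi)
  obtain ⟨a, rfl⟩ := Submodule.mem_span_singleton.mp (hv hw)
  refine le_antisymm ?_ ((Submodule.span_singleton_le_iff_mem _ _).mpr hw)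
  rwa [Submodule.span_singleton_smul_eq (IsUnit.mk0 a (left_ne_zero_of_smul hw0))]

theorem exists_lie_ne_zero (hL : IsAlgebraOfMaximalClass F 𝒜) (hinf : ¬ FiniteDimensional F L)
    {i : ℕ} (hi : 1 ≤ i) : ∃ u ∈ 𝒜 i, ∃ v ∈ 𝒜 1, ⁅u, v⁆ ≠ 0 := by
  by_contra! hzero
  -- The sum of the components up to `i` is then closed under the bracket with the generators.
  set T : Submodule F L := (Icc 1 i).sup 𝒜
  have hle : ∀ {j}, 1 ≤ j → j ≤ i → 𝒜 j ≤ T := fun h1 h2 => le_sup (mem_Icc.mpr ⟨h1, h2⟩)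
  have hclosed : ∀ u ∈ T, ∀ v ∈ 𝒜 1, ⁅u, v⁆ ∈ T := by
    intro u hu v hv
    suffices h : T ≤ T.comap (LieModule.toEnd F L L v) by
      rw [← lie_skew]; exact T.neg_mem (h hu)
    refine Finset.sup_le fun j hj w hw => ?_
    obtain ⟨hj1, hji⟩ := mem_Icc.mp hj
    change ⁅v, w⁆ ∈ T
    rw [← lie_skew]
    rcases hji.eq_or_lt with rfl | hlt
    · rw [hzero w hw v hv, neg_zero]; exact T.zero_mem
    · exact T.neg_mem (hle (by omega) hlt (hL.lie_mem j 1 w hw v hv))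
  have htop : ⊤ ≤ T := by
    simpa only [hL.generated, LieSubalgebra.top_toSubmodule] using
      lieSpan_toSubmodule_le_of_lie_mem (hle le_rfl hi) hclosed
  have := hL.finiteDimensional_component
  have hfin : FiniteDimensional F T := Submodule.finiteDimensional_finset_sup _ _
  rw [top_le_iff.mp htop] at hfin
  exact hinf (Module.finite_def.mpr (Module.Finite.iff_fg.mp hfin))

variable {x y : L}

theorem lie_ne_zero_of_component_one_eq_span_pair (hL : IsAlgebraOfMaximalClass F 𝒜)
    (hinf : ¬ FiniteDimensional F L) (hspan : 𝒜 1 = Submodule.span F {x, y}) : ⁅x, y⁆ ≠ 0 := by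
  intro hxy
  obtain ⟨u, hu, v, hv, huv⟩ := hL.exists_lie_ne_zero hinf le_rfl
  obtain ⟨a, b, rfl⟩ := Submodule.mem_span_pair.mp (hspan ▸ hu)
  obtain ⟨a', b', rfl⟩ := Submodule.mem_span_pair.mp (hspan ▸ hv)
  have hyx : ⁅y, x⁆ = 0 := by rw [← lie_skew, hxy, neg_zero]
  simp [hxy, hyx] at huv

theorem lie_ne_zero_or_lie_ne_zero (hL : IsAlgebraOfMaximalClass F 𝒜)
    (hinf : ¬ FiniteDimensional F L) (hspan : 𝒜 1 = Submodule.span F {x, y}) {i : ℕ} (hi : 1 ≤ i)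
    {w : L} (hw : w ∈ 𝒜 i) (hw0 : w ≠ 0) : ⁅w, x⁆ ≠ 0 ∨ ⁅w, y⁆ ≠ 0 := by
  by_contra! h
  rcases hi.eq_or_lt with rfl | hi
  · have hxy := hL.lie_ne_zero_of_component_one_eq_span_pair hinf hspan
    obtain ⟨a, b, rfl⟩ := Submodule.mem_span_pair.mp (hspan ▸ hw)
    rw [← lie_skew] at h
    simp_all
  · obtain ⟨u, hu, v, hv, huv⟩ := hL.exists_lie_ne_zero hinf (i := i) (by omega)
    rw [hL.component_eq_span_singleton hi hw hw0] at hu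
    obtain ⟨r, rfl⟩ := Submodule.mem_span_singleton.mp hu
    obtain ⟨a, b, rfl⟩ := Submodule.mem_span_pair.mp (hspan ▸ hv)
    simp [h.1, h.2] at huv

theorem exists_lie_eq_smul (hL : IsAlgebraOfMaximalClass F 𝒜) (hinf : ¬ FiniteDimensional F L)
    (hspan : 𝒜 1 = Submodule.span F {x, y}) {i : ℕ} (hi : 1 ≤ i) {w : L} (hw : w ∈ 𝒜 i)
    (hw0 : w ≠ 0) : ∃ w' ∈ 𝒜 (i + 1), w' ≠ 0 ∧
      ∃ a b : F, (a ≠ 0 ∨ b ≠ 0) ∧ ⁅w, x⁆ = a • w' ∧ ⁅w, y⁆ = b • w' := by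
  have hx : ⁅w, x⁆ ∈ 𝒜 (i + 1) :=
    hL.lie_mem i 1 w hw x (hspan ▸ Submodule.subset_span (Set.mem_insert x _))
  have hy : ⁅w, y⁆ ∈ 𝒜 (i + 1) :=
    hL.lie_mem i 1 w hw y (hspan ▸ Submodule.subset_span (Set.mem_insert_of_mem x rfl))
  rcases hL.lie_ne_zero_or_lie_ne_zero hinf hspan hi hw hw0 with h | h
  · rw [hL.component_eq_span_singleton (by omega) hx h] at hy
    obtain ⟨b, hb⟩ := Submodule.mem_span_singleton.mp hy
    exact ⟨_, hx, h, 1, b, by simp, by simp, hb.symm⟩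
  · rw [hL.component_eq_span_singleton (by omega) hy h] at hx
    obtain ⟨a, ha⟩ := Submodule.mem_span_singleton.mp hx
    exact ⟨_, hy, h, a, 1, by simp, ha.symm, by simp⟩

end Components

end IsAlgebraOfMaximalClass

/-- For `𝒜 1` spanned by `x` and `y`, this is the element `x + t y` of the extension of scalars of
the algebra to `K`. It is generic when `t` is transcendental: it then lies in no two-step
centralizer. -/
def genericElement (F : Type*) {K L : Type*} [CommRing F] [CommRing K] [Algebra F K] [LieRing L]
    [LieAlgebra F L] (t : K) (x y : L) : K ⊗[F] L :=
  1 ⊗ₜ x + t ⊗ₜ y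

/-- The left-normed brackets `[y, z, …, z]` in `i` entries, with `z` the generic element `x + t y`,
so that the term of index `1` is `y`; the term of index `0` is junk. For `t` transcendental they
form, together with `z`, a homogeneous basis of the extension of scalars of an infinite-dimensional
algebra of maximal class. -/
def genericSequence (F : Type*) {K L : Type*} [CommRing F] [CommRing K] [Algebra F K] [LieRing L]
    [LieAlgebra F L] (t : K) (x y : L) (i : ℕ) : K ⊗[F] L :=
  (fun v => ⁅v, genericElement F t x y⁆)^[i - 1] (1 ⊗ₜ y)

theorem genericSequence_succ {F K L : Type*} [CommRing F] [CommRing K] [Algebra F K] [LieRing L]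
    [LieAlgebra F L] {t : K} {x y : L} {i : ℕ} (hi : 1 ≤ i) :
    genericSequence F t x y (i + 1) = ⁅genericSequence F t x y i, genericElement F t x y⁆ := by
  obtain ⟨n, rfl⟩ := Nat.exists_eq_add_of_le' hi
  exact Function.iterate_succ_apply' (fun v => ⁅v, genericElement F t x y⁆) n _

namespace IsAlgebraOfMaximalClass

variable {F K L : Type*} [Field F] [Field K] [Algebra F K] [LieRing L] [LieAlgebra F L]
  {𝒜 : ℕ → Submodule F L} {x y : L} {t : K}

theorem exists_genericSequence_eq_tmul (hL : IsAlgebraOfMaximalClass F 𝒜)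
    (hinf : ¬ FiniteDimensional F L) (hspan : 𝒜 1 = Submodule.span F {x, y})
    (ht : Transcendental F t) {i : ℕ} (hi : 1 ≤ i) :
    ∃ s : K, s ≠ 0 ∧ ∃ w ∈ 𝒜 i, w ≠ 0 ∧
      genericSequence F t x y i = s ⊗ₜ[F] w := by
  induction i, hi using Nat.le_induction with
  | base =>
    refine ⟨1, one_ne_zero, y, hspan ▸ Submodule.subset_span (Set.mem_insert_of_mem x rfl), ?_, rfl⟩
    rintro rfl
    exact hL.lie_ne_zero_of_component_one_eq_span_pair hinf hspan (lie_zero x)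
  | succ i hi ih =>
    obtain ⟨s, hs, w, hw, hw0, hv⟩ := ih
    obtain ⟨w', hw', hw'0, a, b, hab, hx, hy⟩ := hL.exists_lie_eq_smul hinf hspan hi hw hw0
    refine ⟨s * (algebraMap F K a + algebraMap F K b * t),
      mul_ne_zero hs (algebraMap_add_algebraMap_mul_ne_zero ht hab), w', hw', hw'0, ?_⟩
    rw [genericSequence_succ hi, hv, genericElement, lie_add,
      LieAlgebra.ExtendScalars.bracket_tmul, LieAlgebra.ExtendScalars.bracket_tmul, hx, hy,
      tmul_smul_eq_mul_algebraMap_tmul, tmul_smul_eq_mul_algebraMap_tmul, ← TensorProduct.add_tmul]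
    congr 1
    ring

theorem exists_lie_genericSequence_eq_smul (hL : IsAlgebraOfMaximalClass F 𝒜)
    (hinf : ¬ FiniteDimensional F L) (hspan : 𝒜 1 = Submodule.span F {x, y})
    (ht : Transcendental F t) {i j : ℕ} (hi : 1 ≤ i) (hj : 1 ≤ j) :
    ∃ c : K, ⁅genericSequence F t x y i, genericSequence F t x y j⁆ =
      c • genericSequence F t x y (i + j) := by
  obtain ⟨s, -, w, hw, -, hv⟩ := hL.exists_genericSequence_eq_tmul hinf hspan ht hi
  obtain ⟨s', -, w', hw', -, hv'⟩ := hL.exists_genericSequence_eq_tmul hinf hspan ht hj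
  obtain ⟨s'', hs'', w'', hw'', hw''0, hv''⟩ :=
    hL.exists_genericSequence_eq_tmul hinf hspan ht (i := i + j) (by omega)
  have hmem := hL.lie_mem i j w hw w' hw'
  rw [hL.component_eq_span_singleton (by omega) hw'' hw''0] at hmem
  obtain ⟨a, ha⟩ := Submodule.mem_span_singleton.mp hmem
  refine ⟨s * s' * algebraMap F K a / s'', ?_⟩
  rw [hv, hv', hv'', LieAlgebra.ExtendScalars.bracket_tmul, ← ha, tmul_smul_eq_mul_algebraMap_tmul,
    TensorProduct.smul_tmul', smul_eq_mul, div_mul_cancel₀ _ hs'']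

theorem smul_add_smul_mem_twoStepCentralizer_iff (hL : IsAlgebraOfMaximalClass F 𝒜)
    (hinf : ¬ FiniteDimensional F L) (hspan : 𝒜 1 = Submodule.span F {x, y})
    (ht : Transcendental F t) {i : ℕ} (hi : 2 ≤ i) {c : K}
    (hc : ⁅genericSequence F t x y i, 1 ⊗ₜ[F] y⁆ = c • genericSequence F t x y (i + 1)) (r s : F) :
    r • x + s • y ∈ twoStepCentralizer 𝒜 i ↔
      algebraMap F K r + (algebraMap F K s - algebraMap F K r * t) * c = 0 := by
  have hmem : r • x + s • y ∈ 𝒜 1 := hspan ▸ Submodule.mem_span_pair.mpr ⟨r, s, rfl⟩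
  obtain ⟨a, ha, w, hw, hw0, hv⟩ :=
    hL.exists_genericSequence_eq_tmul hinf hspan ht (i := i) (by omega)
  obtain ⟨a', ha', w', -, hw'0, hv'⟩ :=
    hL.exists_genericSequence_eq_tmul hinf hspan ht (i := i + 1) (by omega)
  have hgeneric : (1 : K) ⊗ₜ[F] (r • x + s • y) = algebraMap F K r • genericElement F t x y +
      (algebraMap F K s - algebraMap F K r * t) • ((1 : K) ⊗ₜ[F] y) := by
    simp only [genericElement, TensorProduct.tmul_add, tmul_smul_eq_mul_algebraMap_tmul, smul_add,
      TensorProduct.smul_tmul', smul_eq_mul, add_assoc, ← TensorProduct.add_tmul]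
    ring_nf
  have hlie : a ⊗ₜ[F] ⁅w, r • x + s • y⁆ =
      (algebraMap F K r + (algebraMap F K s - algebraMap F K r * t) * c) • (a' ⊗ₜ[F] w') := by
    rw [← hv', add_smul, mul_smul, ← hc, genericSequence_succ (by omega), ← lie_smul, ← lie_smul,
      ← lie_add, ← hgeneric, hv, LieAlgebra.ExtendScalars.bracket_tmul, mul_one]
  rw [mem_twoStepCentralizer_iff (hL.component_eq_span_singleton hi hw hw0), and_iff_right hmem]
  constructor
  · intro h
    rw [h, TensorProduct.tmul_zero, eq_comm] at hlie
    exact (smul_eq_zero.mp hlie).resolve_right (tmul_ne_zero ha' hw'0)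
  · intro h
    by_contra hne
    exact tmul_ne_zero ha hne (by rw [hlie, h, zero_smul])

theorem exists_smul_add_smul_mem_twoStepCentralizer (hL : IsAlgebraOfMaximalClass F 𝒜)
    (hinf : ¬ FiniteDimensional F L) (hspan : 𝒜 1 = Submodule.span F {x, y}) {i : ℕ} (hi : 2 ≤ i) :
    ∃ r s : F, (r ≠ 0 ∨ s ≠ 0) ∧ r • x + s • y ∈ twoStepCentralizer 𝒜 i := by
  obtain ⟨w, hw, v, -, hne⟩ := hL.exists_lie_ne_zero hinf (i := i) (by omega)
  have hw0 : w ≠ 0 := by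
    rintro rfl
    exact hne (zero_lie v)
  obtain ⟨w', -, -, a, b, hab, hx, hy⟩ := hL.exists_lie_eq_smul hinf hspan (by omega) hw hw0
  refine ⟨b, -a, by simpa [or_comm] using hab, ?_⟩
  rw [mem_twoStepCentralizer_iff (hL.component_eq_span_singleton hi hw hw0)]
  refine ⟨hspan ▸ Submodule.mem_span_pair.mpr ⟨b, -a, rfl⟩, ?_⟩
  rw [lie_add, lie_smul, lie_smul, hx, hy, smul_smul, smul_smul, ← add_smul]
  simp [mul_comm]

theorem exists_isSeparatedTable (hL : IsAlgebraOfMaximalClass F 𝒜)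
    (hinf : ¬ FiniteDimensional F L) (ht : Transcendental F t) :
    ∃ c : ℕ → ℕ → K, IsSeparatedTable F c ∧ ∀ i j, 2 ≤ i → 2 ≤ j →
      (twoStepCentralizer 𝒜 i = twoStepCentralizer 𝒜 j ↔ c i 1 = c j 1) := by
  obtain ⟨x, y, hspan⟩ := hL.exists_component_one_eq_span_pair
  have hconst : ∀ i j, 1 ≤ i → 1 ≤ j → ∃ c : K,
      ⁅genericSequence F t x y i, genericSequence F t x y j⁆ =
        c • genericSequence F t x y (i + j) :=
    fun i j => hL.exists_lie_genericSequence_eq_smul hinf hspan ht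
  choose! c hc using hconst
  have hne : ∀ i, 2 ≤ i → genericSequence F t x y i ≠ 0 := by
    intro i hi
    obtain ⟨s, hs, w, -, hw0, hv⟩ :=
      hL.exists_genericSequence_eq_tmul hinf hspan ht (i := i) (by omega)
    exact hv ▸ tmul_ne_zero hs hw0
  have htable : IsBracketTable c := isBracketTable_of_lie_eq_smul hne
    (fun i hi => (genericSequence_succ hi).symm) hc
  have hmem := fun i (hi : 2 ≤ i) => hL.smul_add_smul_mem_twoStepCentralizer_iff hinf hspan ht hi
    (hc i 1 (by omega) le_rfl)
  have hsol := fun i (hi : 2 ≤ i) => hL.exists_smul_add_smul_mem_twoStepCentralizer hinf hspan hi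
  have hle : ∀ i j, 2 ≤ i → 2 ≤ j → c i 1 = c j 1 →
      twoStepCentralizer 𝒜 i ≤ twoStepCentralizer 𝒜 j := by
    intro i j hi hj h u hu
    obtain ⟨r, s, rfl⟩ := Submodule.mem_span_pair.mp (hspan ▸ hu.1)
    rwa [hmem j hj, ← h, ← hmem i hi]
  refine ⟨c, ⟨htable, ?_⟩, fun i j hi hj => ⟨fun h => ?_, fun h => ?_⟩⟩
  · refine (affineIndependent_insert_zero_range_sub_inv ht).mono ?_
    rintro _ ⟨i, hi, rfl⟩
    obtain ⟨r, s, hrs, hu⟩ := hsol i hi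
    exact mem_insert_zero_range_sub_inv_of_algebraMap_add_mul_eq_zero ht hrs ((hmem i hi r s).mp hu)
  · obtain ⟨r, s, hrs, hu⟩ := hsol i hi
    exact eq_of_algebraMap_add_mul_eq_zero ht hrs ((hmem i hi r s).mp hu)
      ((hmem j hj r s).mp (h ▸ hu))
  · exact le_antisymm (hle i j hi hj h) (hle j i hj hi h.symm)

end IsAlgebraOfMaximalClass

theorem mainTheorem9 {p : ℕ} (hp : p.Prime) (hodd : p ≠ 2)
    {F L : Type*} [Field F] [CharP F p] [LieRing L] [LieAlgebra F L]
    (𝒜 : ℕ → Submodule F L) (hL : IsAlgebraOfMaximalClass F 𝒜)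
    (hinf : ¬ FiniteDimensional F L)
    (i : ℕ) (D : Submodule F L) (hD : IsNthTwoStepCentralizer 𝒜 i D) :
    ∃ n : ℕ, (i : ℤ) - 1 ≤ n ∧ FirstOccursAt 𝒜 D (2 * p ^ n) := by
  obtain ⟨m, ⟨hm, rfl, hfirst⟩, rfl⟩ := hD
  obtain ⟨c, hc, hiff⟩ := hL.exists_isSeparatedTable hinf (RatFunc.transcendental_X (K := F))
  have : CharP (RatFunc F) p := charP_of_injective_algebraMap (algebraMap F (RatFunc F)).injective p
  have htwo : (2 : RatFunc F) ≠ 0 :=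
    Ring.two_ne_zero ((ringChar.eq (RatFunc F) p).trans_ne hodd)
  obtain ⟨n, rfl, hcard⟩ := hc.exists_eq_two_mul_prime_pow hp htwo
    ⟨hm, fun j hj hjm h => hfirst j hj hjm ((hiff j m hj hm).mpr h)⟩
  have hle := ncard_image_le_of_forall_eq (Set.finite_Icc 2 (2 * p ^ n))
    fun a ha b hb => (hiff a b ha.1 hb.1).mpr
  exact ⟨n, by omega, hm, rfl, hfirst⟩
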